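/- For $k\in(0,1)$ let $$K(k)=\int_0^{\pi/2}\frac{d\theta}{\sqrt{1-k^2\sin^2\theta}},\qquad E(k)=\int_0^{\pi/2}\sqrt{1-k^2\sin^2\theta}\,d\theta$$ be the complete elliptic integrals of the first and second kind, and let $\mathrm{dn}(\cdot;k)$ be the Jacobi elliptic function, $\mathrm{dn}(u;k)=\sqrt{1-k^2\sin^2\theta}$ where $\theta\in\mathbb R$ is determined by $u=\int_0^{\theta}\frac{dt}{\sqrt{1-k^2\sin^2t}}$. For $L>0$ put, with $K=K(k)$ and $E=E(k)$, $$R=9L^4-2048K^4+2048K^4k^2-2048K^4k^4,$$ $$a=-\frac1{3L^2}\Big[-32(2-k^2)K^2+96EK+\tfrac32L^2-\tfrac12\sqrt R\Big],\qquad b=-\frac{32K^2}{L^2},\qquad c=\frac{\frac32L^2-\frac12\sqrt R}{L^2},$$ $$A=\frac1{27L^6}\Big[\big(1280(-1+k^2-k^4)K^4+9L^4\big)\sqrt{2048(-1+k^2-k^4)K^4+9L^4}+(-16384-16384k^6+24576k^2+24576k^4)K^6+6912L^2(1-k^2+k^4)K^4-27L^6\Big],$$ $$\phi(x)=\phi_k(x)=a+b\left(\mathrm{dn}^2\Big(\frac{2K(k)x}{L};k\Big)-\frac{E(k)}{K(k)}\right),\qquad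 x\in\mathbb R.$$ There is $L_0>0$ such that for every $L>L_0$ there is $k_1\in(0,1)$ with the following properties. For every $k\in(0,k_1)$ one has $R>0$ and $c>0$, and $\phi$ is a smooth $L$-periodic function satisfying $$(\phi-c)\phi''+\frac{\phi'^2}{2}-\phi^3+c\phi=A\qquad\text{on }\mathbb R .$$ The wave depends smoothly on $k$: the map $(k,x)\mapsto\phi_k(x)$ is $C^\infty$ on $(0,k_1)\times\mathbb R$. Moreover, for every $k\in(0,k_1)$: (i) $c^2-3c+\dfrac{32\pi^4}{L^4}<0$; (ii) $\phi(x)-c<0$ for all $x\in[0,L]$. -/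

import Mathlib

open scoped ContDiff

noncomputable section

namespace MCH

/-- Legendre's incomplete elliptic integral of the first kind
`F(θ; k) = ∫₀^θ dt / √(1 - k² sin² t)`. -/
def ellipticF (k θ : ℝ) : ℝ :=
  ∫ t in (0 : ℝ)..θ, 1 / Real.sqrt (1 - k ^ 2 * Real.sin t ^ 2)

/-- The complete elliptic integral of the first kind. -/
def ellipticK (k : ℝ) : ℝ :=
  ∫ t in (0 : ℝ)..(Real.pi / 2), 1 / Real.sqrt (1 - k ^ 2 * Real.sin t ^ 2)

/-- The complete elliptic integral of the second kind. -/
def ellipticE (k : ℝ) : ℝ :=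
  ∫ t in (0 : ℝ)..(Real.pi / 2), Real.sqrt (1 - k ^ 2 * Real.sin t ^ 2)

/-- The Jacobi amplitude `am(u; k)`: the inverse function of `θ ↦ F(θ; k)`, which for `|k| < 1`
is a bijection of `ℝ` onto itself (only such `k` are used). -/
def jacobiAm (k : ℝ) : ℝ → ℝ :=
  Function.invFun (ellipticF k)

/-- The Jacobi elliptic function `dn(u; k) = √(1 - k² sin² am(u; k))` (real `u`, `|k| < 1`). -/
def jacobiDn (u k : ℝ) : ℝ :=
  Real.sqrt (1 - k ^ 2 * Real.sin (jacobiAm k u) ^ 2)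

/-- The expression under the square root in the formulas for `a` and `c`. -/
def radicand (L k : ℝ) : ℝ :=
  9 * L ^ 4 - 2048 * ellipticK k ^ 4 + 2048 * ellipticK k ^ 4 * k ^ 2
    - 2048 * ellipticK k ^ 4 * k ^ 4

/-- The parameter `a`. -/
def paramA (L k : ℝ) : ℝ :=
  -(1 / (3 * L ^ 2)) *
    (-32 * (2 - k ^ 2) * ellipticK k ^ 2 + 96 * ellipticE k * ellipticK k
      + 3 / 2 * L ^ 2 - 1 / 2 * Real.sqrt (radicand L k))

/-- The parameter `b`. -/
def paramB (L k : ℝ) : ℝ :=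
  -(32 * ellipticK k ^ 2 / L ^ 2)

/-- The wave speed `c`. -/
def waveSpeed (L k : ℝ) : ℝ :=
  (3 / 2 * L ^ 2 - 1 / 2 * Real.sqrt (radicand L k)) / L ^ 2

/-- The integration constant `A`. -/
def constA (L k : ℝ) : ℝ :=
  1 / (27 * L ^ 6) *
    ((1280 * (-1 + k ^ 2 - k ^ 4) * ellipticK k ^ 4 + 9 * L ^ 4) *
        Real.sqrt (2048 * (-1 + k ^ 2 - k ^ 4) * ellipticK k ^ 4 + 9 * L ^ 4)
      + (-16384 - 16384 * k ^ 6 + 24576 * k ^ 2 + 24576 * k ^ 4) * ellipticK k ^ 6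
      + 6912 * L ^ 2 * (1 - k ^ 2 + k ^ 4) * ellipticK k ^ 4 - 27 * L ^ 6)

/-- The dnoidal wave `φ(x) = a + b (dn²(2 K(k) x / L; k) - E(k) / K(k))`. -/
def dnoidal (L k x : ℝ) : ℝ :=
  paramA L k + paramB L k *
    (jacobiDn (2 * ellipticK k * x / L) k ^ 2 - ellipticE k / ellipticK k)

/-- `φ` is the profile of a smooth `L`-periodic travelling wave with (positive) speed `c` and
integration constant `A`: it is smooth, `L`-periodic and satisfies
`(φ - c) φ'' + φ'² / 2 - φ³ + c φ = A` on `ℝ`. -/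
structure IsPeriodicTravelingWave (L c A : ℝ) (φ : ℝ → ℝ) : Prop where
  speed_pos : 0 < c
  smooth : ContDiff ℝ ∞ φ
  periodic : Function.Periodic φ L
  ode : ∀ x : ℝ,
    (φ x - c) * deriv (deriv φ) x + deriv φ x ^ 2 / 2 - φ x ^ 3 + c * φ x = A

end MCH

end

/-! Put q = 1 - k² + k⁴, r = K²/L² and w = dn²(2Kx/L; k). Since R = 9L⁴ - 2048 q K⁴, the speed c is
the smaller root of c² - 3c + 512 q r² = 0. Hence c > 0, and (i) becomes π⁴ < 16 q K⁴
(`pi_pow_four_lt`). In powers of k² the first-order terms of q and (2K/π)⁴ cancel, so K is needed to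
first order: K ≥ (π/2)(1 + k²/4).

The terms in E cancel (`dnoidal_eq`), leaving φ - c = (32r/3)(2 - k² - 3w) - 4c/3. Since w ≥ 1 - k²,
this is negative for small k, which is (ii). The first and second derivatives of dn² satisfy
polynomial identities in dn², so the ODE reduces to algebra modulo the quadratic for c.

Joint smoothness passes from F to its inverse, the amplitude, by the implicit function theorem. -/

open Set Filter Topology MeasureTheory

namespace MCH

/-! ### Smooth dependence of integrals on parameters -/

/-- A parametric integral over `[0, 1]` of a jointly smooth function is smooth. -/
theorem contDiffOn_integral_zero_one {P : Type*} [NormedAddCommGroup P] [NormedSpace ℝ P]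
    {s : Set P} (hs : IsOpen s) {h : P → ℝ → ℝ}
    (hh : ContDiffOn ℝ ∞ (fun q : P × ℝ => h q.1 q.2) (s ×ˢ univ)) :
    ContDiffOn ℝ ∞ (fun p => ∫ t in (0 : ℝ)..1, h p t) s := by
  -- The integral is the convolution at 0 of the indicator of (0, 1] with y ↦ h p (-y). The cutoff
  -- makes the second factor compactly supported, and it equals 1 at every -t with t in (0, 1].
  let χ : ContDiffBump (0 : ℝ) := ⟨2, 3, by norm_num, by norm_num⟩
  let g : P → ℝ → ℝ := fun p y => χ y * h p (-y)
  let f : ℝ → ℝ := (Ioc (0 : ℝ) 1).indicator (fun _ => 1)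
  have hf : LocallyIntegrable f volume := by
    refine Integrable.locallyIntegrable ?_
    rw [integrable_indicator_iff measurableSet_Ioc]
    exact integrableOn_const (by simp)
  have hg : ContDiffOn ℝ ∞ ↿g (s ×ˢ univ) := by
    have h1 : ContDiffOn ℝ ∞ (fun q : P × ℝ => χ q.2) (s ×ˢ univ) :=
      (χ.contDiff.comp contDiff_snd).contDiffOn
    have h2 : ContDiffOn ℝ ∞ (fun q : P × ℝ => h q.1 (-q.2)) (s ×ˢ univ) := by
      have h3 : ContDiff ℝ ∞ (fun q : P × ℝ => (q.1, -q.2)) := by fun_prop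
      exact hh.comp h3.contDiffOn (fun q hq => ⟨hq.1, mem_univ _⟩)
    exact h1.mul h2
  have key := contDiffOn_convolution_right_with_param_comp (μ := volume) (n := ⊤)
    (ContinuousLinearMap.mul ℝ ℝ) (v := fun _ : P => (0 : ℝ)) contDiffOn_const hs
    (isCompact_closedBall (0 : ℝ) 3)
    (g := g) (f := f) (fun p x _ hx => by
      have : χ x = 0 := χ.zero_of_le_dist (by
        simp only [Metric.mem_closedBall, not_le] at hx
        exact hx.le)
      simp [g, this]) hf hg
  refine key.congr (fun p _ => ?_)
  rw [intervalIntegral.integral_of_le zero_le_one, ← integral_indicator measurableSet_Ioc]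
  simp only [convolution, ContinuousLinearMap.mul_apply']
  refine integral_congr_ae (Eventually.of_forall fun t => ?_)
  by_cases ht : t ∈ Ioc (0 : ℝ) 1
  · have : χ (-t) = 1 := χ.one_of_mem_closedBall (by
      simp only [Metric.mem_closedBall, dist_zero_right, norm_neg, Real.norm_eq_abs]
      rw [abs_of_pos ht.1]
      exact ht.2.trans one_le_two)
    simp [f, g, ht, this]
  · simp [f, ht]

/-! ### The amplitude and dn at a fixed modulus -/

section Modulus

variable {k : ℝ}

theorem one_sub_sq_mul_sin_sq_pos (hk : k ∈ Ioo (-1 : ℝ) 1) (t : ℝ) :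
    0 < 1 - k ^ 2 * Real.sin t ^ 2 := by
  have h1 : k ^ 2 < 1 := by nlinarith [hk.1, hk.2]
  nlinarith [Real.sin_sq_le_one t, sq_nonneg (Real.sin t), sq_nonneg k]

theorem continuous_ellipticF_integrand (hk : k ∈ Ioo (-1 : ℝ) 1) :
    Continuous (fun t : ℝ => 1 / Real.sqrt (1 - k ^ 2 * Real.sin t ^ 2)) := by
  refine continuous_const.div (by fun_prop) fun t => ?_
  exact (Real.sqrt_pos.2 (one_sub_sq_mul_sin_sq_pos hk t)).ne'

theorem hasDerivAt_ellipticF (hk : k ∈ Ioo (-1 : ℝ) 1) (θ : ℝ) :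
    HasDerivAt (ellipticF k) (1 / Real.sqrt (1 - k ^ 2 * Real.sin θ ^ 2)) θ :=
  intervalIntegral.integral_hasDerivAt_right
    ((continuous_ellipticF_integrand hk).intervalIntegrable _ _)
    (continuous_ellipticF_integrand hk).stronglyMeasurable.stronglyMeasurableAtFilter
    (continuous_ellipticF_integrand hk).continuousAt

theorem ellipticF_strictMono (hk : k ∈ Ioo (-1 : ℝ) 1) : StrictMono (ellipticF k) := by
  refine strictMono_of_deriv_pos fun θ => ?_
  rw [(hasDerivAt_ellipticF hk θ).deriv]
  have := Real.sqrt_pos.2 (one_sub_sq_mul_sin_sq_pos hk θ)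
  positivity

theorem one_le_ellipticF_integrand (hk : k ∈ Ioo (-1 : ℝ) 1) (t : ℝ) :
    1 ≤ 1 / Real.sqrt (1 - k ^ 2 * Real.sin t ^ 2) := by
  rw [le_div_iff₀ (Real.sqrt_pos.2 (one_sub_sq_mul_sin_sq_pos hk t)), one_mul]
  exact Real.sqrt_le_one.2 (by nlinarith [mul_nonneg (sq_nonneg k) (sq_nonneg (Real.sin t))])

/-- Comparison with θ makes F unbounded in both directions, hence surjective. -/
theorem monotone_ellipticF_sub_id (hk : k ∈ Ioo (-1 : ℝ) 1) :
    Monotone (fun θ => ellipticF k θ - θ) := by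
  have hd : ∀ θ, HasDerivAt (fun θ => ellipticF k θ - θ)
      (1 / Real.sqrt (1 - k ^ 2 * Real.sin θ ^ 2) - 1) θ :=
    fun θ => (hasDerivAt_ellipticF hk θ).sub (hasDerivAt_id θ)
  refine monotone_of_deriv_nonneg (fun θ => (hd θ).differentiableAt) fun θ => ?_
  rw [(hd θ).deriv]
  exact sub_nonneg.2 (one_le_ellipticF_integrand hk θ)

theorem ellipticF_zero (k : ℝ) : ellipticF k 0 = 0 := by
  simp [ellipticF]

theorem ellipticF_surjective (hk : k ∈ Ioo (-1 : ℝ) 1) : Function.Surjective (ellipticF k) := by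
  have hc : Continuous (ellipticF k) :=
    continuous_iff_continuousAt.2 fun θ => (hasDerivAt_ellipticF hk θ).continuousAt
  refine hc.surjective ?_ ?_
  · refine tendsto_atTop_mono' atTop ?_ tendsto_id
    filter_upwards [eventually_ge_atTop 0] with θ hθ
    have := monotone_ellipticF_sub_id hk hθ
    simp only [ellipticF_zero, id] at *
    linarith
  · refine tendsto_atBot_mono' atBot ?_ tendsto_id
    filter_upwards [eventually_le_atBot 0] with θ hθ
    have := monotone_ellipticF_sub_id hk hθ
    simp only [ellipticF_zero, id] at *
    linarith

theorem ellipticF_jacobiAm (hk : k ∈ Ioo (-1 : ℝ) 1) (u : ℝ) :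
    ellipticF k (jacobiAm k u) = u :=
  Function.invFun_eq (ellipticF_surjective hk u)

theorem jacobiAm_ellipticF (hk : k ∈ Ioo (-1 : ℝ) 1) (θ : ℝ) :
    jacobiAm k (ellipticF k θ) = θ :=
  Function.leftInverse_invFun (ellipticF_strictMono hk).injective θ

/-- The integrand has period π and is symmetric about π/2, so each period contributes 2K. -/
theorem ellipticF_add_pi (hk : k ∈ Ioo (-1 : ℝ) 1) (θ : ℝ) :
    ellipticF k (θ + Real.pi) = ellipticF k θ + 2 * ellipticK k := by
  set f : ℝ → ℝ := fun t => 1 / Real.sqrt (1 - k ^ 2 * Real.sin t ^ 2) with hf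
  have hi : ∀ a b, IntervalIntegrable f volume a b :=
    (continuous_ellipticF_integrand hk).intervalIntegrable
  have hp : Function.Periodic f Real.pi := fun t => by
    simp [hf, Real.sin_add_pi]
  have h1 : ∫ t in θ..θ + Real.pi, f t = ∫ t in (0 : ℝ)..Real.pi, f t := by
    simpa using hp.intervalIntegral_add_eq θ 0
  have h2 : ∫ t in (Real.pi / 2)..Real.pi, f t = ∫ t in (0 : ℝ)..(Real.pi / 2), f t := by
    have h3 := intervalIntegral.integral_comp_sub_left (a := 0) (b := Real.pi / 2) f Real.pi
    have h4 : (fun t => f (Real.pi - t)) = f := by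
      funext t
      simp [hf, Real.sin_pi_sub]
    simp only [h4, sub_zero, sub_half] at h3
    exact h3.symm
  have h5 := intervalIntegral.integral_add_adjacent_intervals (hi 0 θ) (hi θ (θ + Real.pi))
  have h6 := intervalIntegral.integral_add_adjacent_intervals (hi 0 (Real.pi / 2))
    (hi (Real.pi / 2) Real.pi)
  have h7 : ellipticF k (θ + Real.pi) = ∫ t in (0 : ℝ)..θ + Real.pi, f t := rfl
  have h8 : ellipticF k θ = ∫ t in (0 : ℝ)..θ, f t := rfl
  have h9 : ellipticK k = ∫ t in (0 : ℝ)..(Real.pi / 2), f t := rfl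
  linarith

theorem jacobiAm_add_two_mul_ellipticK (hk : k ∈ Ioo (-1 : ℝ) 1) (u : ℝ) :
    jacobiAm k (u + 2 * ellipticK k) = jacobiAm k u + Real.pi := by
  rw [← jacobiAm_ellipticF hk (jacobiAm k u + Real.pi), ellipticF_add_pi hk,
    ellipticF_jacobiAm hk]

theorem jacobiDn_add_two_mul_ellipticK (hk : k ∈ Ioo (-1 : ℝ) 1) (u : ℝ) :
    jacobiDn (u + 2 * ellipticK k) k = jacobiDn u k := by
  simp [jacobiDn, jacobiAm_add_two_mul_ellipticK hk, Real.sin_add_pi]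

theorem jacobiDn_sq (hk : k ∈ Ioo (-1 : ℝ) 1) (u : ℝ) :
    jacobiDn u k ^ 2 = 1 - k ^ 2 * Real.sin (jacobiAm k u) ^ 2 :=
  Real.sq_sqrt (one_sub_sq_mul_sin_sq_pos hk _).le

theorem one_sub_sq_le_jacobiDn_sq (hk : k ∈ Ioo (-1 : ℝ) 1) (u : ℝ) :
    1 - k ^ 2 ≤ jacobiDn u k ^ 2 := by
  rw [jacobiDn_sq hk]
  nlinarith [Real.sin_sq_le_one (jacobiAm k u), sq_nonneg k]

end Modulus

/-! ### Joint smoothness in the modulus and the argument -/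

/-- `F(θ; k)` is jointly smooth in `(k, θ)` for `|k| < 1`. -/
theorem contDiffOn_ellipticF :
    ContDiffOn ℝ ∞ (fun p : ℝ × ℝ => ellipticF p.1 p.2) (Ioo (-1 : ℝ) 1 ×ˢ univ) := by
  -- Rescaling t to θt fixes the interval of integration and moves θ into the integrand.
  have h1 : ContDiffOn ℝ ∞
      (fun p : ℝ × ℝ => ∫ t in (0 : ℝ)..1,
        1 / Real.sqrt (1 - p.1 ^ 2 * Real.sin (p.2 * t) ^ 2)) (Ioo (-1 : ℝ) 1 ×ˢ univ) := by
    refine contDiffOn_integral_zero_one (isOpen_Ioo.prod isOpen_univ) ?_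
    have h2 : ContDiffOn ℝ ∞
        (fun q : (ℝ × ℝ) × ℝ => 1 - q.1.1 ^ 2 * Real.sin (q.1.2 * q.2) ^ 2)
        ((Ioo (-1 : ℝ) 1 ×ˢ univ) ×ˢ univ) := by
      refine ContDiff.contDiffOn ?_
      fun_prop
    refine contDiffOn_const.div (h2.sqrt fun q hq => ?_) fun q hq => ?_
    · exact (one_sub_sq_mul_sin_sq_pos hq.1.1 _).ne'
    · exact (Real.sqrt_pos.2 (one_sub_sq_mul_sin_sq_pos hq.1.1 _)).ne'
  refine (contDiffOn_snd.mul h1).congr fun p _ => ?_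
  have := intervalIntegral.smul_integral_comp_mul_left (a := 0) (b := 1)
    (fun t => 1 / Real.sqrt (1 - p.1 ^ 2 * Real.sin t ^ 2)) p.2
  simp only [mul_zero, mul_one, smul_eq_mul] at this
  exact this.symm

theorem contDiffOn_ellipticK : ContDiffOn ℝ ∞ ellipticK (Ioo (-1 : ℝ) 1) := by
  have h : ContDiff ℝ ∞ (fun k : ℝ => (k, Real.pi / 2)) := by fun_prop
  exact contDiffOn_ellipticF.comp h.contDiffOn fun k hk => ⟨hk, mem_univ _⟩

/-- The amplitude is jointly smooth in `(k, u)` for `|k| < 1`, by the implicit function theorem. -/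
theorem contDiffOn_jacobiAm :
    ContDiffOn ℝ ∞ (fun p : ℝ × ℝ => jacobiAm p.1 p.2) (Ioo (-1 : ℝ) 1 ×ˢ univ) := by
  rintro ⟨k, u⟩ ⟨hk, -⟩
  refine ContDiffAt.contDiffWithinAt ?_
  set θ := jacobiAm k u with hθ
  let G : (ℝ × ℝ) × ℝ → ℝ := fun q => ellipticF q.1.1 q.2 - q.1.2
  have hG : ContDiffAt ℝ ∞ G ((k, u), θ) := by
    have h1 : ContDiffAt ℝ ∞ (fun p : ℝ × ℝ => ellipticF p.1 p.2) (k, θ) :=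
      contDiffOn_ellipticF.contDiffAt
        ((isOpen_Ioo.prod isOpen_univ).mem_nhds ⟨hk, mem_univ _⟩)
    have h2 : ContDiffAt ℝ ∞ (fun q : (ℝ × ℝ) × ℝ => (q.1.1, q.2)) ((k, u), θ) := by
      fun_prop
    have h3 : ContDiffAt ℝ ∞ (fun q : (ℝ × ℝ) × ℝ => q.1.2) ((k, u), θ) := by
      fun_prop
    exact (ContDiffAt.comp ((k, u), θ) h1 h2).sub h3
  have hn : (∞ : WithTop ℕ∞) ≠ 0 := by simp
  have hd : HasDerivAt (fun t => G ((k, u), t))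
      (1 / Real.sqrt (1 - k ^ 2 * Real.sin θ ^ 2)) θ :=
    (hasDerivAt_ellipticF hk θ).sub_const u
  have hne : 1 / Real.sqrt (1 - k ^ 2 * Real.sin θ ^ 2) ≠ 0 :=
    (zero_lt_one.trans_le (one_le_ellipticF_integrand hk θ)).ne'
  have hinv : (fderiv ℝ G ((k, u), θ) ∘L .inr ℝ (ℝ × ℝ) ℝ).IsInvertible := by
    have h4 : HasFDerivAt (fun t : ℝ => G ((k, u), t))
        (fderiv ℝ G ((k, u), θ) ∘L .inr ℝ (ℝ × ℝ) ℝ) θ :=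
      HasFDerivAt.comp θ (hG.differentiableAt hn).hasFDerivAt
        (hasFDerivAt_prodMk_right (k, u) θ)
    rw [h4.unique hd.hasFDerivAt]
    refine ⟨ContinuousLinearEquiv.unitsEquivAut ℝ (Units.mk0 _ hne), ?_⟩
    ext
    simp
  refine (hG.contDiffAt_implicitFunction hn hinv).congr_of_eventuallyEq ?_
  -- The implicit function ψ solves F(ψ(k, u); k) = u near the base point; injectivity of F
  -- identifies it with the amplitude.
  have hk' : ∀ᶠ p : ℝ × ℝ in 𝓝 (k, u), p.1 ∈ Ioo (-1 : ℝ) 1 :=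
    continuousAt_fst.eventually (isOpen_Ioo.mem_nhds hk)
  filter_upwards [hG.eventually_apply_implicitFunction hn hinv, hk'] with p hp hpk
  have h0 : G ((k, u), θ) = 0 := by
    simp [G, hθ, ellipticF_jacobiAm hk]
  rw [h0] at hp
  have hp' : p.2 = ellipticF p.1 (hG.implicitFunction hn hinv p) := (sub_eq_zero.1 hp).symm
  conv_lhs => rw [hp']
  exact jacobiAm_ellipticF hpk _

/-! ### Differential equations for dn² -/

section Derivatives

variable {k : ℝ}

theorem hasDerivAt_jacobiAm (hk : k ∈ Ioo (-1 : ℝ) 1) (u : ℝ) :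
    HasDerivAt (jacobiAm k) (jacobiDn u k) u := by
  have hc : ContinuousAt (jacobiAm k) u := by
    have h1 : ContDiffAt ℝ ∞ (fun p : ℝ × ℝ => jacobiAm p.1 p.2) (k, u) :=
      contDiffOn_jacobiAm.contDiffAt
        ((isOpen_Ioo.prod isOpen_univ).mem_nhds ⟨hk, mem_univ _⟩)
    exact ContinuousAt.comp (f := fun u : ℝ => (k, u)) h1.continuousAt (by fun_prop)
  have h := HasDerivAt.of_local_left_inverse hc (hasDerivAt_ellipticF hk (jacobiAm k u))
    (zero_lt_one.trans_le (one_le_ellipticF_integrand hk _)).ne'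
    (Eventually.of_forall fun v => ellipticF_jacobiAm hk v)
  rwa [one_div, inv_inv] at h

theorem hasDerivAt_jacobiDn_sq (hk : k ∈ Ioo (-1 : ℝ) 1) (u : ℝ) :
    HasDerivAt (fun u => jacobiDn u k ^ 2)
      (-2 * k ^ 2 * (Real.sin (jacobiAm k u) * Real.cos (jacobiAm k u) * jacobiDn u k)) u := by
  have h := (((hasDerivAt_jacobiAm hk u).sin.pow 2).const_mul (k ^ 2)).const_sub 1
  have he : (fun u => jacobiDn u k ^ 2) =
      fun u => 1 - k ^ 2 * Real.sin (jacobiAm k u) ^ 2 := funext (jacobiDn_sq hk)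
  rw [he]
  refine h.congr_deriv ?_
  push_cast
  ring

theorem hasDerivAt_jacobiDn (hk : k ∈ Ioo (-1 : ℝ) 1) (u : ℝ) :
    HasDerivAt (fun u => jacobiDn u k)
      (-k ^ 2 * (Real.sin (jacobiAm k u) * Real.cos (jacobiAm k u))) u := by
  have hpos : 0 < jacobiDn u k := Real.sqrt_pos.2 (one_sub_sq_mul_sin_sq_pos hk _)
  have h := (hasDerivAt_jacobiDn_sq hk u).sqrt (by positivity)
  have he : (fun u => Real.sqrt (jacobiDn u k ^ 2)) = fun u => jacobiDn u k :=
    funext fun v => Real.sqrt_sq (Real.sqrt_nonneg _)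
  rw [he, Real.sqrt_sq hpos.le] at h
  refine h.congr_deriv ?_
  field_simp

theorem hasDerivAt_deriv_jacobiDn_sq (hk : k ∈ Ioo (-1 : ℝ) 1) (u : ℝ) :
    HasDerivAt (fun u => -2 * k ^ 2 *
        (Real.sin (jacobiAm k u) * Real.cos (jacobiAm k u) * jacobiDn u k))
      (2 * (-3 * (jacobiDn u k ^ 2) ^ 2 + 2 * (2 - k ^ 2) * jacobiDn u k ^ 2 - (1 - k ^ 2))) u := by
  have ha := hasDerivAt_jacobiAm hk u
  have h := ((ha.sin.mul ha.cos).mul (hasDerivAt_jacobiDn hk u)).const_mul (-2 * k ^ 2)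
  refine h.congr_deriv ?_
  simp only [Pi.mul_apply]
  have h1 := jacobiDn_sq hk u
  have h2 := Real.sin_sq_add_cos_sq (jacobiAm k u)
  generalize Real.sin (jacobiAm k u) = S at *
  generalize Real.cos (jacobiAm k u) = C at *
  generalize jacobiDn u k = D at *
  have h3 : C ^ 2 = 1 - S ^ 2 := by linarith
  have h4 : -2 * k ^ 2 * ((C * D * C + S * (-S * D)) * D + S * C * (-k ^ 2 * (S * C))) =
      -2 * k ^ 2 * ((C ^ 2 - S ^ 2) * D ^ 2 - k ^ 2 * S ^ 2 * C ^ 2) := by ring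
  rw [h4, h3, h1]
  ring

theorem deriv_jacobiDn_sq_sq (hk : k ∈ Ioo (-1 : ℝ) 1) (u : ℝ) :
    (-2 * k ^ 2 * (Real.sin (jacobiAm k u) * Real.cos (jacobiAm k u) * jacobiDn u k)) ^ 2 =
      4 * (jacobiDn u k ^ 2 * (1 - jacobiDn u k ^ 2) * (jacobiDn u k ^ 2 - (1 - k ^ 2))) := by
  have h1 := jacobiDn_sq hk u
  have h3 : Real.cos (jacobiAm k u) ^ 2 = 1 - Real.sin (jacobiAm k u) ^ 2 := by
    linarith [Real.sin_sq_add_cos_sq (jacobiAm k u)]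
  simp only [mul_pow, h1, h3]
  ring

end Derivatives

/-! ### Bounds on K and the wave speed -/

section Bounds

variable {k : ℝ}

/-- Integrates 1/√(1 - x) ≥ 1 + x/2 with x = k² sin² t. -/
theorem ellipticK_lower_bound (hk : k ∈ Ioo (-1 : ℝ) 1) :
    Real.pi / 2 * (1 + k ^ 2 / 4) ≤ ellipticK k := by
  have h1 : ∫ t in (0 : ℝ)..(Real.pi / 2), (1 + k ^ 2 / 2 * Real.sin t ^ 2) =
      Real.pi / 2 * (1 + k ^ 2 / 4) := by
    rw [intervalIntegral.integral_add (by simp)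
      (Continuous.intervalIntegrable (by fun_prop) _ _)]
    simp only [intervalIntegral.integral_const_mul, integral_sin_sq]
    simp
    ring
  rw [← h1]
  refine intervalIntegral.integral_mono_on (by positivity)
    (Continuous.intervalIntegrable (by fun_prop) _ _)
    ((continuous_ellipticF_integrand hk).intervalIntegrable _ _) fun t _ => ?_
  have hpos := one_sub_sq_mul_sin_sq_pos hk t
  rw [le_div_iff₀ (Real.sqrt_pos.2 hpos)]
  set x := k ^ 2 * Real.sin t ^ 2 with hx
  have hx0 : 0 ≤ x := by positivity
  have h2 : 1 + k ^ 2 / 2 * Real.sin t ^ 2 = 1 + x / 2 := by rw [hx]; ring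
  rw [h2]
  -- After squaring: (1 + x/2)²(1 - x) = 1 - 3x²/4 - x³/4 ≤ 1.
  refine abs_le_of_sq_le_sq' ?_ zero_le_one |>.2
  rw [mul_pow, Real.sq_sqrt hpos.le]
  nlinarith [mul_nonneg hx0 (sq_nonneg x), sq_nonneg x]

theorem ellipticK_pos (hk : k ∈ Ioo (-1 : ℝ) 1) : 0 < ellipticK k :=
  lt_of_lt_of_le (by positivity) (ellipticK_lower_bound hk)

theorem ellipticK_le_pi (hk : k ∈ Ioo (0 : ℝ) (1 / 2)) : ellipticK k ≤ Real.pi := by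
  have hk' : k ∈ Ioo (-1 : ℝ) 1 := ⟨by linarith [hk.1], by linarith [hk.2]⟩
  have h1 : ∫ _ in (0 : ℝ)..(Real.pi / 2), (2 : ℝ) = Real.pi := by simp
  rw [← h1]
  refine intervalIntegral.integral_mono_on (by positivity)
    ((continuous_ellipticF_integrand hk').intervalIntegrable _ _) (by simp) fun t _ => ?_
  have hpos := one_sub_sq_mul_sin_sq_pos hk' t
  rw [div_le_iff₀ (Real.sqrt_pos.2 hpos)]
  have h2 : 1 / 2 ≤ Real.sqrt (1 - k ^ 2 * Real.sin t ^ 2) := by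
    refine Real.le_sqrt_of_sq_le ?_
    have : k ^ 2 ≤ 1 / 4 := by nlinarith [hk.1, hk.2]
    nlinarith [Real.sin_sq_le_one t, sq_nonneg (Real.sin t), sq_nonneg k]
  linarith

theorem pi_pow_four_lt (hk : k ∈ Ioo (0 : ℝ) 1) :
    Real.pi ^ 4 < 16 * (ellipticK k ^ 4 * (1 - k ^ 2 + k ^ 4)) := by
  have hK := ellipticK_lower_bound (k := k) ⟨by linarith [hk.1], hk.2⟩
  have h1 : (Real.pi / 2 * (1 + k ^ 2 / 4)) ^ 4 ≤ ellipticK k ^ 4 :=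
    pow_le_pow_left₀ (by positivity) hK 4
  have hy : 0 < k ^ 2 := pow_pos hk.1 2
  have h4 : k ^ 4 = (k ^ 2) ^ 2 := by ring
  rw [h4]
  generalize k ^ 2 = y at *
  have hq : 0 < 1 - y + y ^ 2 := by nlinarith [sq_nonneg (y - 1)]
  have h2 : 1 + y + 3 / 8 * y ^ 2 ≤ (1 + y / 4) ^ 4 := by
    have : (1 + y / 4) ^ 4 = 1 + y + 3 / 8 * y ^ 2 + (y ^ 3 / 16 + y ^ 4 / 256) := by ring
    rw [this]
    have : 0 ≤ y ^ 3 / 16 + y ^ 4 / 256 := by positivity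
    linarith
  have h3 : 1 < (1 + y / 4) ^ 4 * (1 - y + y ^ 2) := by
    refine lt_of_lt_of_le ?_ (mul_le_mul_of_nonneg_right h2 hq.le)
    have : (1 + y + 3 / 8 * y ^ 2) * (1 - y + y ^ 2) =
      1 + (3 / 8 * y ^ 2 + 5 / 8 * y ^ 3 + 3 / 8 * y ^ 4) := by ring
    rw [this]
    have : 0 < 3 / 8 * y ^ 2 + 5 / 8 * y ^ 3 + 3 / 8 * y ^ 4 := by positivity
    linarith
  calc Real.pi ^ 4 = Real.pi ^ 4 * 1 := (mul_one _).symm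
    _ < Real.pi ^ 4 * ((1 + y / 4) ^ 4 * (1 - y + y ^ 2)) :=
        mul_lt_mul_of_pos_left h3 (by positivity)
    _ = 16 * ((Real.pi / 2 * (1 + y / 4)) ^ 4 * (1 - y + y ^ 2)) := by ring
    _ ≤ 16 * (ellipticK k ^ 4 * (1 - y + y ^ 2)) := by gcongr

theorem radicand_eq (L k : ℝ) :
    radicand L k = 9 * L ^ 4 - 2048 * (ellipticK k ^ 4 * (1 - k ^ 2 + k ^ 4)) := by
  unfold radicand
  ring

theorem radicand_pos {L : ℝ} (hL : 20 < L) (hk : k ∈ Ioo (0 : ℝ) (1 / 2)) :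
    0 < radicand L k := by
  have hK0 : 0 < ellipticK k := ellipticK_pos ⟨by linarith [hk.1], by linarith [hk.2]⟩
  have hK : ellipticK k ^ 4 ≤ 4 ^ 4 :=
    pow_le_pow_left₀ hK0.le ((ellipticK_le_pi hk).trans Real.pi_le_four) 4
  have hL4 : (20 : ℝ) ^ 4 < L ^ 4 := pow_lt_pow_left₀ hL (by norm_num) (by norm_num)
  have hy : k ^ 2 ≤ 1 := by nlinarith [hk.1, hk.2]
  have hq : 1 - k ^ 2 + k ^ 4 ≤ 1 := by nlinarith [sq_nonneg k]
  have : ellipticK k ^ 4 * (1 - k ^ 2 + k ^ 4) ≤ 4 ^ 4 * 1 :=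
    mul_le_mul hK hq (by nlinarith [sq_nonneg (k ^ 2 - 1)]) (by norm_num)
  rw [radicand_eq]
  norm_num at *
  -- 2048 · 4⁴ = 524288 is less than 9 · 20⁴ = 1440000.
  linarith

theorem waveSpeed_sq_sub {L : ℝ} (hL : 0 < L) (hR : 0 < radicand L k) :
    waveSpeed L k ^ 2 - 3 * waveSpeed L k =
      -(512 * (ellipticK k ^ 4 * (1 - k ^ 2 + k ^ 4)) / L ^ 4) := by
  have h := (Real.sq_sqrt hR.le).trans (radicand_eq L k)
  unfold waveSpeed
  generalize Real.sqrt (radicand L k) = σ at *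
  field_simp
  linear_combination h

theorem waveSpeed_pos {L : ℝ} (hL : 0 < L) (hk : k ∈ Ioo (0 : ℝ) 1) :
    0 < waveSpeed L k := by
  have h1 : Real.sqrt (radicand L k) < 3 * L ^ 2 := by
    rw [Real.sqrt_lt' (by positivity), radicand_eq]
    have := pi_pow_four_lt hk
    nlinarith [pow_pos Real.pi_pos 4]
  unfold waveSpeed
  refine div_pos ?_ (by positivity)
  linarith

theorem waveSpeed_quadratic_neg {L : ℝ} (hL : 0 < L) (hk : k ∈ Ioo (0 : ℝ) 1)
    (hR : 0 < radicand L k) :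
    waveSpeed L k ^ 2 - 3 * waveSpeed L k + 32 * Real.pi ^ 4 / L ^ 4 < 0 := by
  rw [waveSpeed_sq_sub hL hR, neg_add_lt_iff_lt_add, add_zero]
  refine div_lt_div_of_pos_right ?_ (by positivity)
  linarith [pi_pow_four_lt hk]

end Bounds

/-! ### The dnoidal wave -/

/-- In the formula for the wave the terms with `E(k)` cancel. -/
theorem dnoidal_eq {L k : ℝ} (hL : 0 < L) (hk : k ∈ Ioo (-1 : ℝ) 1) (x : ℝ) :
    dnoidal L k x = 32 * (2 - k ^ 2) * ellipticK k ^ 2 / (3 * L ^ 2) - waveSpeed L k / 3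
      - 32 * ellipticK k ^ 2 / L ^ 2 * jacobiDn (2 * ellipticK k / L * x) k ^ 2 := by
  have hK := (ellipticK_pos hk).ne'
  have hx : 2 * ellipticK k * x / L = 2 * ellipticK k / L * x := by ring
  unfold dnoidal paramA paramB waveSpeed
  rw [hx]
  field_simp
  ring

theorem dnoidal_sub_waveSpeed_neg {L k : ℝ} (hL : 0 < L) (hk : k ∈ Ioo (0 : ℝ) (1 / 2))
    (x : ℝ) : dnoidal L k x - waveSpeed L k < 0 := by
  have hk' : k ∈ Ioo (-1 : ℝ) 1 := ⟨by linarith [hk.1], by linarith [hk.2]⟩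
  have hc := waveSpeed_pos (k := k) hL ⟨hk.1, hk'.2⟩
  have hd := one_sub_sq_le_jacobiDn_sq hk' (2 * ellipticK k / L * x)
  have hy : k ^ 2 ≤ 1 / 4 := by nlinarith [hk.1, hk.2]
  rw [dnoidal_eq hL hk']
  generalize jacobiDn (2 * ellipticK k / L * x) k ^ 2 = w at *
  have h1 : 32 * (2 - k ^ 2) * ellipticK k ^ 2 / (3 * L ^ 2) - waveSpeed L k / 3
      - 32 * ellipticK k ^ 2 / L ^ 2 * w - waveSpeed L k =
      32 * ellipticK k ^ 2 / (3 * L ^ 2) * (2 - k ^ 2 - 3 * w) - 4 / 3 * waveSpeed L k := by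
    field_simp
    ring
  rw [h1]
  -- As w ≥ 1 - k², the last factor is at most 2k² - 1, negative because k² ≤ 1/4.
  have h2 : 32 * ellipticK k ^ 2 / (3 * L ^ 2) * (2 - k ^ 2 - 3 * w) ≤ 0 :=
    mul_nonpos_of_nonneg_of_nonpos (by positivity) (by linarith)
  linarith

theorem contDiffOn_dnoidal {L : ℝ} (hL : 20 < L) :
    ContDiffOn ℝ ∞ (fun p : ℝ × ℝ => dnoidal L p.1 p.2) (Ioo (0 : ℝ) (1 / 2) ×ˢ univ) := by
  have hL0 : 0 < L := by linarith
  set s : Set (ℝ × ℝ) := Ioo (0 : ℝ) (1 / 2) ×ˢ univ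
  have hmem : ∀ p ∈ s, p.1 ∈ Ioo (-1 : ℝ) 1 := fun p hp =>
    ⟨by linarith [hp.1.1], by linarith [hp.1.2]⟩
  have hk : ContDiffOn ℝ ∞ (fun p : ℝ × ℝ => p.1) s := contDiffOn_fst
  have hK : ContDiffOn ℝ ∞ (fun p : ℝ × ℝ => ellipticK p.1) s :=
    contDiffOn_ellipticK.comp contDiffOn_fst hmem
  have hR : ContDiffOn ℝ ∞ (fun p : ℝ × ℝ => radicand L p.1) s := by
    unfold radicand
    fun_prop
  have hc : ContDiffOn ℝ ∞ (fun p : ℝ × ℝ => waveSpeed L p.1) s := by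
    have hS := hR.sqrt fun p hp => (radicand_pos hL hp.1).ne'
    unfold waveSpeed
    fun_prop
  have hm : ContDiffOn ℝ ∞
      (fun p : ℝ × ℝ => jacobiAm p.1 (2 * ellipticK p.1 / L * p.2)) s := by
    have h1 : ContDiffOn ℝ ∞ (fun p : ℝ × ℝ => (p.1, 2 * ellipticK p.1 / L * p.2)) s := by
      fun_prop
    exact contDiffOn_jacobiAm.comp h1 fun p hp => ⟨hmem p hp, mem_univ _⟩
  have hsin := hm.sin
  have h : ContDiffOn ℝ ∞ (fun p : ℝ × ℝ =>
      32 * (2 - p.1 ^ 2) * ellipticK p.1 ^ 2 / (3 * L ^ 2) - waveSpeed L p.1 / 3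
      - 32 * ellipticK p.1 ^ 2 / L ^ 2 *
        (1 - p.1 ^ 2 * Real.sin (jacobiAm p.1 (2 * ellipticK p.1 / L * p.2)) ^ 2)) s := by
    fun_prop
  refine h.congr fun p hp => ?_
  rw [dnoidal_eq hL0 (hmem p hp), jacobiDn_sq (hmem p hp)]

theorem contDiff_dnoidal {L k : ℝ} (hL : 20 < L) (hk : k ∈ Ioo (0 : ℝ) (1 / 2)) :
    ContDiff ℝ ∞ (dnoidal L k) := by
  have h : ContDiff ℝ ∞ (fun x : ℝ => (k, x)) := by fun_prop
  refine contDiff_iff_contDiffAt.2 fun x => ?_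
  have h1 : ContDiffAt ℝ ∞ (fun p : ℝ × ℝ => dnoidal L p.1 p.2) (k, x) :=
    (contDiffOn_dnoidal hL).contDiffAt
      ((isOpen_Ioo.prod isOpen_univ).mem_nhds ⟨hk, mem_univ _⟩)
  exact ContDiffAt.comp (f := fun x : ℝ => (k, x)) x h1 h.contDiffAt

theorem dnoidal_periodic {L k : ℝ} (hL : 0 < L) (hk : k ∈ Ioo (-1 : ℝ) 1) :
    Function.Periodic (dnoidal L k) L := fun x => by
  have h : 2 * ellipticK k * (x + L) / L = 2 * ellipticK k * x / L + 2 * ellipticK k := by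
    field_simp
  simp only [dnoidal, h, jacobiDn_add_two_mul_ellipticK hk]

/-- The root in A is the one in c, and √R = L²(3 - 2c), so A is a polynomial in k, r and c. -/
theorem constA_eq {L : ℝ} (hL : 0 < L) (k : ℝ) :
    constA L k = 1 / 27 * ((9 - 1280 * (1 - k ^ 2 + k ^ 4) * (ellipticK k ^ 2 / L ^ 2) ^ 2)
        * (3 - 2 * waveSpeed L k)
      + (-16384 - 16384 * k ^ 6 + 24576 * k ^ 2 + 24576 * k ^ 4) * (ellipticK k ^ 2 / L ^ 2) ^ 3
      + 6912 * (1 - k ^ 2 + k ^ 4) * (ellipticK k ^ 2 / L ^ 2) ^ 2 - 27) := by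
  have hR : 2048 * (-1 + k ^ 2 - k ^ 4) * ellipticK k ^ 4 + 9 * L ^ 4 = radicand L k := by
    rw [radicand_eq]
    ring
  unfold constA waveSpeed
  rw [hR]
  generalize Real.sqrt (radicand L k) = σ
  field_simp
  ring

theorem dnoidal_ode {L k : ℝ} (hL : 0 < L) (hk : k ∈ Ioo (-1 : ℝ) 1) (hR : 0 < radicand L k)
    (x : ℝ) :
    (dnoidal L k x - waveSpeed L k) * deriv (deriv (dnoidal L k)) x
      + deriv (dnoidal L k) x ^ 2 / 2 - dnoidal L k x ^ 3 + waveSpeed L k * dnoidal L k x =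
      constA L k := by
  set m := 2 * ellipticK k / L with hm
  set b := 32 * ellipticK k ^ 2 / L ^ 2 with hb
  have hlin : ∀ x : ℝ, HasDerivAt (fun x => m * x) m x := fun x => by
    simpa using (hasDerivAt_id x).const_mul m
  have hfun := funext (dnoidal_eq hL hk)
  have hd1 : deriv (dnoidal L k) = fun x => -b * ((-2 * k ^ 2 *
      (Real.sin (jacobiAm k (m * x)) * Real.cos (jacobiAm k (m * x)) * jacobiDn (m * x) k)) * m) := by
    funext x
    have h := (((hasDerivAt_jacobiDn_sq hk (m * x)).comp x (hlin x)).const_mul b).const_sub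
      (32 * (2 - k ^ 2) * ellipticK k ^ 2 / (3 * L ^ 2) - waveSpeed L k / 3)
    rw [hfun]
    refine h.deriv.trans ?_
    ring
  have hd2 := (((hasDerivAt_deriv_jacobiDn_sq hk (m * x)).comp x (hlin x)).mul_const m).const_mul
    (-b) |>.deriv
  have hsq := deriv_jacobiDn_sq_sq hk (m * x)
  rw [hd1]
  simp only [Function.comp_def] at hd2
  rw [hd2, dnoidal_eq hL hk, ← hb, mul_pow, mul_pow, hsq]
  have hc := waveSpeed_sq_sub hL hR
  rw [constA_eq hL]
  generalize jacobiDn (m * x) k ^ 2 = w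
  generalize waveSpeed L k = c at *
  have hm2 : m ^ 2 = 4 * (ellipticK k ^ 2 / L ^ 2) := by
    rw [hm]
    ring
  have hb' : b = 32 * (ellipticK k ^ 2 / L ^ 2) := by
    rw [hb]
    ring
  have hX : 32 * (2 - k ^ 2) * ellipticK k ^ 2 / (3 * L ^ 2) =
      32 * (2 - k ^ 2) / 3 * (ellipticK k ^ 2 / L ^ 2) := by
    ring
  have hQ : 512 * (ellipticK k ^ 4 * (1 - k ^ 2 + k ^ 4)) / L ^ 4 =
      512 * (1 - k ^ 2 + k ^ 4) * (ellipticK k ^ 2 / L ^ 2) ^ 2 := by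
    ring
  rw [hQ] at hc
  rw [hX, hb']
  generalize ellipticK k ^ 2 / L ^ 2 = r at *
  -- The factor of `hc` removes the powers c³ and c² from -φ³ + cφ, where φ is a c-free term minus
  -- c/3. The factor of `hm2` is what multiplies m² in (φ - c)φ'' + φ'²/2.
  linear_combination (c / 27 - (32 * (2 - k ^ 2) / 3 * r - 32 * r * w) / 3 - 2 / 9) * hc
    + (32 * r) * (-(32 * (2 - k ^ 2) / 3 * r - 32 * r * w - 4 * c / 3) *
      (2 * (-3 * w ^ 2 + 2 * (2 - k ^ 2) * w - (1 - k ^ 2)))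
      + 64 * r * (w * (1 - w) * (w - (1 - k ^ 2)))) * hm2

end MCH

theorem lemma2p2 :
    ∃ L₀ : ℝ, 0 < L₀ ∧ ∀ L : ℝ, L₀ < L →
      ∃ k₁ ∈ Set.Ioo (0 : ℝ) 1,
        ContDiffOn ℝ ∞ (fun p : ℝ × ℝ => MCH.dnoidal L p.1 p.2)
          (Set.Ioo (0 : ℝ) k₁ ×ˢ Set.univ) ∧
        ∀ k ∈ Set.Ioo (0 : ℝ) k₁,
          0 < MCH.radicand L k ∧
          MCH.IsPeriodicTravelingWave L (MCH.waveSpeed L k) (MCH.constA L k)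
            (MCH.dnoidal L k) ∧
          MCH.waveSpeed L k ^ 2 - 3 * MCH.waveSpeed L k + 32 * Real.pi ^ 4 / L ^ 4 < 0 ∧
          ∀ x ∈ Set.Icc (0 : ℝ) L, MCH.dnoidal L k x - MCH.waveSpeed L k < 0 := by
  -- The values 20 and 1/2 serve R > 0, through K ≤ π ≤ 4; k < 1/2 also gives (ii).
  refine ⟨20, by norm_num, fun L hL => ⟨1 / 2, by norm_num, MCH.contDiffOn_dnoidal hL, ?_⟩⟩
  intro k hk
  have hL0 : 0 < L := by linarith
  have hk1 : k ∈ Ioo (0 : ℝ) 1 := ⟨hk.1, by linarith [hk.2]⟩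
  have hk' : k ∈ Ioo (-1 : ℝ) 1 := ⟨by linarith [hk.1], hk1.2⟩
  have hR := MCH.radicand_pos hL hk
  refine ⟨hR, ⟨MCH.waveSpeed_pos hL0 hk1, MCH.contDiff_dnoidal hL hk, MCH.dnoidal_periodic hL0 hk',
    MCH.dnoidal_ode hL0 hk' hR⟩, MCH.waveSpeed_quadratic_neg hL0 hk1 hR,
    fun x _ => MCH.dnoidal_sub_waveSpeed_neg hL0 hk x⟩
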